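/- Let $S$ be a monoid. A left $S$-act is a non-empty set $B$ with a map $S\times B\to B$, $(s,b)\mapsto sb$, such that $1b=b$ and $s(tb)=(st)b$ for all $s,t\in S$, $b\in B$; right $S$-acts are defined dually, and $S$ and each principal right ideal $aS$ ($a\in S$) are right $S$-acts under multiplication. For a right $S$-act $A$ and a left $S$-act $B$, $A\otimes B$ is the quotient of $A\times B$ by the equivalence relation generated by the pairs $((as,b),(a,sb))$, $a\in A$, $b\in B$, $s\in S$, and $a\otimes b$ is the class of $(a,b)$. The left $S$-act $B$ is *principally weakly flat* if for every $a\in S$ the map $aS\otimes B\to S\otimes B$, $x\otimes b\mapsto x\otimes b$, is injective; $\mathcal{PWF}$ denotes the class of principally weakly flat left $S$-acts. A *skeleton* over $S$ is a sequence $\mathcal S=(s_1,t_1,\dots,s_m,t_m)\in S^{2m}$ with $m\ge 1$. A *tossing over $A$ and $B$ with skeleton $\mathcal S$* connecting $(a,b)\in A\times B$ to $(a',b')\in A\times B$ consists of elements $a_1=a,a_2,\dots,a_m,a_{m+1}=a'$ of $A$ and $b_1,\dots,b_m$ of $B$ with $a_is_i=a_{i+1}t_i$ for $1\le i\le m$,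 $b=s_1b_1$, $t_ib_i=s_{i+1}b_{i+1}$ for $1\le i<m$, and $t_mb_m=b'$. Let $L_S$ be the first-order language with equality having one unary function symbol $\lambda_s$ for each $s\in S$ and no other symbols; left $S$-acts are $L_S$-structures with $\lambda_s(x)=sx$. A class $\mathcal C$ of left $S$-acts is *axiomatisable* if there is a set $\Sigma$ of sentences of $L_S$ whose (non-empty) models are exactly the members of $\mathcal C$. The following conditions are equivalent: (i) the class $\mathcal{PWF}$ is axiomatisable; (ii) the class $\mathcal{PWF}$ is closed under ultraproducts; (iii) for every skeleton $\mathcal S$ over $S$ and every $a\in S$ there exist finitely many skeletons $\mathcal S_1,\dots,\mathcal S_{\tau(a,\mathcal S)}$ over $S$ such that, for any principally weakly flat left $S$-act $B$ and any $b,b'\in B$, if $(a,b)$ and $(a,b')$ are connected by a tossing over $S$ and $B$ with skeleton $\mathcal S$, then $(a,b)$ and $(a,b')$ are connected by a tossing over $aS$ and $B$ with skeleton $\mathcal S_k$ for some $k\in\{1,\dots,\tau(a,\mathcal S)\}$. -/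

import Mathlib

open FirstOrder

universe u v w

namespace MonoidAct

section Tensor

/-- The relation `(a s, b) ~ (a, s b)` on `A × B`, where `A` is a right `S`-act
(an action of `Sᵐᵒᵖ`, so that `a s` is `MulOpposite.op s • a`) and `B` is a left `S`-act. -/
inductive TensorRel (S : Type u) [Monoid S] (A : Type v) (B : Type w)
    [MulAction Sᵐᵒᵖ A] [MulAction S B] : A × B → A × B → Prop
  | mk (a : A) (s : S) (b : B) : TensorRel S A B (MulOpposite.op s • a, b) (a, s • b)

/-- The tensor product `A ⊗ B` over `S`: the quotient of `A × B` by the equivalence relation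
generated by `TensorRel`. -/
def Tensor (S : Type u) [Monoid S] (A : Type v) (B : Type w)
    [MulAction Sᵐᵒᵖ A] [MulAction S B] : Type (max v w) :=
  Quot (TensorRel S A B)

/-- The map `f ⊗ I_B : A ⊗ B → A' ⊗ B`, `a ⊗ b ↦ f a ⊗ b`, induced by a morphism `f` of
right `S`-acts. -/
def Tensor.map {S : Type u} [Monoid S] {A A' : Type v} [MulAction Sᵐᵒᵖ A] [MulAction Sᵐᵒᵖ A']
    (f : A →[Sᵐᵒᵖ] A') (B : Type w) [MulAction S B] : Tensor S A B → Tensor S A' B :=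
  Quot.map (fun p => (f p.1, p.2)) (by
    rintro _ _ ⟨a, s, b⟩
    simp only [map_smul]
    exact TensorRel.mk (f a) s b)

end Tensor

section Flat

/-- The principal right ideal `aS`, as a subact of the right `S`-act `S`. -/
def principalRightIdeal {S : Type u} [Monoid S] (a : S) : SubMulAction Sᵐᵒᵖ S where
  carrier := {x | ∃ s : S, x = a * s}
  smul_mem' := by
    rintro c _ ⟨s, rfl⟩
    exact ⟨s * c.unop, by rw [MulOpposite.smul_eq_mul_unop, mul_assoc]⟩

theorem mem_principalRightIdeal_self {S : Type u} [Monoid S] (a : S) :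
    a ∈ principalRightIdeal a :=
  ⟨1, (mul_one a).symm⟩

/-- The generator `a` as an element of `aS`. -/
def generator {S : Type u} [Monoid S] (a : S) : principalRightIdeal a :=
  ⟨a, mem_principalRightIdeal_self a⟩

/-- A left `S`-act `B` is principally weakly flat if `- ⊗ B` maps the inclusion `aS → S` of each
principal right ideal to an injective map `aS ⊗ B → S ⊗ B`. -/
def IsPrincipallyWeaklyFlat (S : Type u) [Monoid S] (B : Type w) [MulAction S B] : Prop :=
  ∀ a : S, Function.Injective (Tensor.map (principalRightIdeal a).subtype B)

end Flat

section Tossings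

/-- A skeleton `(s₁, t₁, …, sₘ, tₘ)` of length `m = n + 1 ≥ 1` over `S`
(with `sᵢ` and `tᵢ` indexed from `0` to `n`). -/
structure Skeleton (S : Type u) where
  n : ℕ
  s : Fin (n + 1) → S
  t : Fin (n + 1) → S

/-- A tossing over `A` and `B` with skeleton `σ = (s₁, t₁, …, sₘ, tₘ)` connecting `(a, b)` to
`(a', b')`: elements `a₁ = a, a₂, …, aₘ, aₘ₊₁ = a'` of `A` and `b₁, …, bₘ` of `B` such that
`aᵢ sᵢ = aᵢ₊₁ tᵢ` for `1 ≤ i ≤ m`, and `b = s₁ b₁`, `tᵢ bᵢ = sᵢ₊₁ bᵢ₊₁` for `1 ≤ i < m`,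
`tₘ bₘ = b'`. -/
structure Tossing {S : Type u} [Monoid S] {A : Type v} {B : Type w}
    [MulAction Sᵐᵒᵖ A] [MulAction S B] (σ : Skeleton S) (a : A) (b : B) (a' : A) (b' : B) where
  x : Fin (σ.n + 2) → A
  y : Fin (σ.n + 1) → B
  x_first : x 0 = a
  x_step : ∀ i : Fin (σ.n + 1),
    MulOpposite.op (σ.s i) • x i.castSucc = MulOpposite.op (σ.t i) • x i.succ
  x_last : x (Fin.last (σ.n + 1)) = a'
  y_first : b = σ.s 0 • y 0
  y_step : ∀ i : Fin σ.n, σ.t i.castSucc • y i.castSucc = σ.s i.succ • y i.succ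
  y_last : σ.t (Fin.last σ.n) • y (Fin.last σ.n) = b'

/-- `(a, b)` and `(a', b')` are connected by some tossing over `A` and `B` with skeleton `σ`. -/
def Connected {S : Type u} [Monoid S] {A : Type v} {B : Type w}
    [MulAction Sᵐᵒᵖ A] [MulAction S B] (σ : Skeleton S) (a : A) (b : B) (a' : A) (b' : B) : Prop :=
  Nonempty (Tossing σ a b a' b')

end Tossings

section Language

/-- The function symbols of the language of left `S`-acts: a unary symbol `lam s` for each
`s : S`, and nothing else. -/
inductive ActFunction (S : Type u) : ℕ → Type u
  | lam (s : S) : ActFunction S 1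

/-- The first-order language of left `S`-acts. -/
def actLanguage (S : Type u) : FirstOrder.Language.{u, 0} where
  Functions := ActFunction S
  Relations := fun _ => Empty

/-- The structure `M` for the language of left `S`-acts is (the interpretation of) a left `S`-act
belonging to the class `K`. -/
def InClass {S : Type u} [Monoid S] (K : (B : Type w) → MulAction S B → Prop)
    (M : Type w) [(actLanguage S).Structure M] : Prop :=
  ∃ act : MulAction S M,
    (∀ (s : S) (m : M),
      FirstOrder.Language.Structure.funMap (L := actLanguage S) (ActFunction.lam s) ![m] = s • m) ∧
    K M act

/-- The class `K` of left `S`-acts is axiomatisable: for some set `T` of first-order sentences, the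
(non-empty) models of `T` are exactly the left `S`-acts in `K`. -/
def IsAxiomatisable {S : Type u} [Monoid S] (K : (B : Type w) → MulAction S B → Prop) : Prop :=
  ∃ T : (actLanguage S).Theory,
    ∀ (M : Type w) [Nonempty M] [(actLanguage S).Structure M], M ⊨ T ↔ InClass K M

/-- The class `K` of left `S`-acts is closed under ultraproducts. -/
def IsClosedUnderUltraproducts {S : Type u} [Monoid S]
    (K : (B : Type w) → MulAction S B → Prop) : Prop :=
  ∀ (I : Type w) (U : Ultrafilter I) (B : I → Type w) [∀ i, Nonempty (B i)]
    [∀ i, (actLanguage S).Structure (B i)],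
    (∀ i, InClass K (B i)) → InClass K ((U : Filter I).Product B)

end Language

/-- The class of principally weakly flat left `S`-acts. -/
def PWF (S : Type u) [Monoid S] (B : Type w) (act : MulAction S B) : Prop :=
  letI := act
  IsPrincipallyWeaklyFlat S B

end MonoidAct

/-! A tossing splits into two independent halves: a chain in the right act and a chain in the left
act `B`, coupled only by the skeleton. The left half is a first-order condition on its two endpoints
(`chainFormula`); the right half, between `a` and `a`, does not involve `B`. So principal weak
flatness says that certain left chains imply a possibly infinite disjunction of left chains
(`isPrincipallyWeaklyFlat_iff`). Condition (iii) makes each disjunction finite, hence a sentence. If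
no finite disjunction suffices, an ultraproduct of counterexamples indexed by finite sets of
skeletons is not principally weakly flat, by Łoś's theorem. -/

namespace MonoidAct

/-! ### Tossings and equality in tensor products -/

section Tossings

variable {S : Type u} [Monoid S] {A : Type v} {B : Type w} [MulAction Sᵐᵒᵖ A] [MulAction S B]

/-- The part of a tossing with skeleton `σ` that concerns the right act. -/
def RightChain (σ : Skeleton S) (a a' : A) : Prop :=
  ∃ x : Fin (σ.n + 2) → A, x 0 = a ∧
    (∀ i : Fin (σ.n + 1),
      MulOpposite.op (σ.s i) • x i.castSucc = MulOpposite.op (σ.t i) • x i.succ) ∧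
    x (Fin.last (σ.n + 1)) = a'

/-- The part of a tossing with skeleton `σ` that concerns the left act. -/
def LeftChain (σ : Skeleton S) (b b' : B) : Prop :=
  ∃ y : Fin (σ.n + 1) → B, b = σ.s 0 • y 0 ∧
    (∀ i : Fin σ.n, σ.t i.castSucc • y i.castSucc = σ.s i.succ • y i.succ) ∧
    σ.t (Fin.last σ.n) • y (Fin.last σ.n) = b'

theorem connected_iff {σ : Skeleton S} {a a' : A} {b b' : B} :
    Connected σ a b a' b' ↔ RightChain σ a a' ∧ LeftChain σ b b' := by
  constructor
  · rintro ⟨T⟩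
    exact ⟨⟨T.x, T.x_first, T.x_step, T.x_last⟩, ⟨T.y, T.y_first, T.y_step, T.y_last⟩⟩
  · rintro ⟨⟨x, hx₀, hx, hx₁⟩, ⟨y, hy₀, hy, hy₁⟩⟩
    exact ⟨⟨x, y, hx₀, hx, hx₁, hy₀, hy, hy₁⟩⟩

/-- Two pairs are joined by a tossing of length one. -/
def Step (S : Type u) [Monoid S] {A : Type v} {B : Type w} [MulAction Sᵐᵒᵖ A] [MulAction S B]
    (p q : A × B) : Prop :=
  ∃ (s t : S) (y : B), p.2 = s • y ∧
    MulOpposite.op s • p.1 = MulOpposite.op t • q.1 ∧ t • y = q.2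

theorem Step.symm {p q : A × B} : Step S p q → Step S q p := by
  rintro ⟨s, t, y, h₁, h₂, h₃⟩
  exact ⟨t, s, y, h₃.symm, h₂.symm, h₁.symm⟩

/-- Needed because skeletons have length at least one: equal pairs still require a tossing. -/
theorem Step.refl (p : A × B) : Step S p p :=
  ⟨1, 1, p.2, (one_smul _ _).symm, rfl, one_smul _ _⟩

theorem TensorRel.step {p q : A × B} : TensorRel S A B p q → Step S p q := by
  rintro ⟨a, s, b⟩
  exact ⟨1, s, b, (one_smul _ _).symm, by simp, rfl⟩

theorem Tensor.sound (a : A) (s : S) (b : B) :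
    (Quot.mk _ (MulOpposite.op s • a, b) : Tensor S A B) = Quot.mk _ (a, s • b) :=
  Quot.sound (TensorRel.mk a s b)

theorem Step.tensor_eq {p q : A × B} :
    Step S p q → (Quot.mk _ p : Tensor S A B) = Quot.mk _ q := by
  obtain ⟨a, b⟩ := p
  obtain ⟨a', b'⟩ := q
  rintro ⟨s, t, y, rfl, h₂, rfl⟩
  rw [← Tensor.sound, ← Tensor.sound]
  exact congrArg (fun z => Quot.mk _ (z, y)) h₂

theorem Step.connected {p q : A × B} :
    Step S p q → ∃ σ : Skeleton S, Connected σ p.1 p.2 q.1 q.2 := by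
  rintro ⟨s, t, y, h₁, h₂, h₃⟩
  refine ⟨⟨0, fun _ => s, fun _ => t⟩, ⟨⟨![p.1, q.1], fun _ => y, rfl, ?_, rfl, h₁, ?_, h₃⟩⟩⟩
  · intro i
    fin_cases i
    exact h₂
  · exact fun i => i.elim0

theorem Step.cons_connected {p q r : A × B} (h : Step S p q) {σ : Skeleton S}
    (hσ : Connected σ q.1 q.2 r.1 r.2) :
    ∃ τ : Skeleton S, Connected τ p.1 p.2 r.1 r.2 := by
  obtain ⟨s, t, y, h₁, h₂, h₃⟩ := h
  obtain ⟨T⟩ := hσ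
  refine ⟨⟨σ.n + 1, Fin.cons s σ.s, Fin.cons t σ.t⟩,
    ⟨⟨Fin.cons p.1 T.x, Fin.cons y T.y, rfl, ?_, ?_, h₁, ?_, ?_⟩⟩⟩
  · intro i
    refine Fin.cases ?_ (fun j => ?_) i
    · simpa [T.x_first] using h₂
    · simpa using T.x_step j
  · exact T.x_last
  · intro i
    refine Fin.cases ?_ (fun j => ?_) i
    · simpa [← T.y_first] using h₃
    · simpa using T.y_step j
  · exact T.y_last

theorem exists_connected_of_tensor_eq {p q : A × B}
    (h : (Quot.mk _ p : Tensor S A B) = Quot.mk _ q) :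
    ∃ σ : Skeleton S, Connected σ p.1 p.2 q.1 q.2 := by
  -- Both directions are carried together, so that the symmetric case is a swap.
  have key : ∀ {p q : A × B}, Relation.EqvGen (TensorRel S A B) p q →
      Relation.TransGen (Step S) p q ∧ Relation.TransGen (Step S) q p := by
    intro p q h
    induction h with
    | rel p q h => exact ⟨.single h.step, .single h.step.symm⟩
    | refl p => exact ⟨.single (Step.refl p), .single (Step.refl p)⟩
    | symm p q _ ih => exact ih.symm
    | trans p q r _ _ ih₁ ih₂ => exact ⟨ih₁.1.trans ih₂.1, ih₂.2.trans ih₁.2⟩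
  have hpq := (key (Quot.eqvGen_exact h)).1
  clear h
  induction hpq using Relation.TransGen.head_induction_on with
  | single h => exact h.connected
  | head h _ ih =>
    obtain ⟨σ, hσ⟩ := ih
    exact h.cons_connected hσ

theorem Connected.tensor_eq {σ : Skeleton S} {a a' : A} {b b' : B} (h : Connected σ a b a' b') :
    (Quot.mk _ (a, b) : Tensor S A B) = Quot.mk _ (a', b') := by
  obtain ⟨T⟩ := h
  have key : ∀ i : Fin (σ.n + 1), (Quot.mk _ (T.x 0, σ.s 0 • T.y 0) : Tensor S A B) =
      Quot.mk _ (T.x i.succ, σ.t i • T.y i) := by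
    intro i
    induction i using Fin.induction with
    | zero => exact Step.tensor_eq ⟨_, _, _, rfl, T.x_step 0, rfl⟩
    | succ i ih =>
      rw [ih, T.y_step]
      exact Step.tensor_eq ⟨_, _, _, rfl, T.x_step i.succ, rfl⟩
  have := key (Fin.last σ.n)
  rwa [T.x_first, ← T.y_first, Fin.succ_last, T.x_last, T.y_last] at this

theorem mk_eq_mk_generator (a s : S) (b : B) (h : a * s ∈ principalRightIdeal a) :
    (Quot.mk _ (⟨a * s, h⟩, b) : Tensor S (principalRightIdeal a) B) =
      Quot.mk _ (generator a, s • b) :=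
  Tensor.sound (generator a) s b

/-- Since `as ⊗ b = a ⊗ sb` already in `aS ⊗ B`, injectivity need only be tested on pairs whose
first entry is the generator. -/
theorem isPrincipallyWeaklyFlat_iff :
    IsPrincipallyWeaklyFlat S B ↔ ∀ (a : S) (b b' : B) (σ : Skeleton S), Connected σ a b a b' →
      ∃ τ : Skeleton S, Connected τ (generator a) b (generator a) b' := by
  constructor
  · intro h a b b' σ hσ
    have : (Quot.mk _ (generator a, b) : Tensor S (principalRightIdeal a) B) =
        Quot.mk _ (generator a, b') := h a hσ.tensor_eq
    exact exists_connected_of_tensor_eq this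
  · rintro h a ⟨⟨_, s, rfl⟩, b⟩ ⟨⟨_, s', rfl⟩, b'⟩ heq
    have heq' : (Quot.mk _ (a * s, b) : Tensor S S B) = Quot.mk _ (a * s', b') := heq
    refine (mk_eq_mk_generator a s b _).trans (Eq.trans ?_ (mk_eq_mk_generator a s' b' _).symm)
    have h₁ : ∀ (r : S) (c : B), (Quot.mk _ (a * r, c) : Tensor S S B) = Quot.mk _ (a, r • c) :=
      fun r c => Tensor.sound a r c
    rw [h₁, h₁] at heq'
    obtain ⟨σ, hσ⟩ := exists_connected_of_tensor_eq heq'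
    obtain ⟨τ, hτ⟩ := h a _ _ σ hσ
    exact hτ.tensor_eq

end Tossings

/-! ### First-order sentences about chains -/

section Language

open FirstOrder.Language

/-- The symbol for multiplication by `s`, as a function symbol of the language. -/
abbrev lamSymbol {S : Type u} (s : S) : (actLanguage S).Functions 1 := ActFunction.lam s

/-- A left `S`-act as a structure for the language of left `S`-acts. -/
@[reducible] def actStructure (S : Type u) [Monoid S] (B : Type w) [MulAction S B] :
    (actLanguage S).Structure B where
  funMap := fun
    | .lam s => fun v => s • v 0
  RelMap := fun r => nomatch r

/-- The formula expressing that two elements are joined by the left act part of a tossing. -/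
noncomputable def chainFormula {S : Type u} (σ : Skeleton S) :
    (actLanguage S).Formula (Fin 2) :=
  Formula.iExs (Fin (σ.n + 1)) <|
    (Term.var (Sum.inl 0)).equal ((lamSymbol (σ.s 0)).apply₁ (Term.var (Sum.inr 0))) ⊓
    (Formula.iInf (fun i : Fin σ.n =>
      ((lamSymbol (σ.t i.castSucc)).apply₁ (Term.var (Sum.inr i.castSucc))).equal
        ((lamSymbol (σ.s i.succ)).apply₁ (Term.var (Sum.inr i.succ)))) ⊓
    ((lamSymbol (σ.t (Fin.last σ.n))).apply₁ (Term.var (Sum.inr (Fin.last σ.n)))).equal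
      (Term.var (Sum.inl 1)))

/-- The sentence expressing that elements joined by a `σ`-chain are joined by a `τ`-chain for
some `τ ∈ F`. -/
noncomputable def chainSentence {S : Type u} (σ : Skeleton S) (F : Finset (Skeleton S)) :
    (actLanguage S).Sentence :=
  Formula.iAlls (Fin 2) <| Formula.relabel Sum.inr <|
    (chainFormula σ).imp (Formula.iSup (fun τ : F => chainFormula τ.1))

/-- The sentence `∀ x, 1 x = x`. -/
noncomputable def oneSentence (S : Type u) [Monoid S] : (actLanguage S).Sentence :=
  Formula.iAlls Unit <|
    ((lamSymbol (1 : S)).apply₁ (Term.var (Sum.inr ()))).equal (Term.var (Sum.inr ()))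

/-- The sentence `∀ x, (s t) x = s (t x)`. -/
noncomputable def mulSentence {S : Type u} [Monoid S] (s t : S) : (actLanguage S).Sentence :=
  Formula.iAlls Unit <|
    ((lamSymbol (s * t)).apply₁ (Term.var (Sum.inr ()))).equal
      ((lamSymbol s).apply₁ ((lamSymbol t).apply₁ (Term.var (Sum.inr ()))))

variable {S : Type u} [Monoid S] {M : Type w} [(actLanguage S).Structure M]

theorem realize_chainFormula [MulAction S M]
    (h : ∀ (s : S) (m : M), Structure.funMap (lamSymbol s) ![m] = s • m)
    (σ : Skeleton S) (v : Fin 2 → M) :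
    (chainFormula σ).Realize v ↔ LeftChain σ (v 0) (v 1) := by
  simp [chainFormula, LeftChain, Formula.realize_iExs, h]

theorem realize_chainSentence [MulAction S M]
    (h : ∀ (s : S) (m : M), Structure.funMap (lamSymbol s) ![m] = s • m)
    (σ : Skeleton S) (F : Finset (Skeleton S)) :
    M ⊨ chainSentence σ F ↔
      ∀ b b' : M, LeftChain σ b b' → ∃ τ ∈ F, LeftChain τ b b' := by
  simp only [Sentence.Realize, chainSentence, Formula.realize_iAlls, Formula.realize_relabel,
    Formula.realize_imp, Formula.realize_iSup, realize_chainFormula h]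
  constructor
  · intro H b b' hb
    simpa using H ![b, b'] hb
  · intro H i hi
    simpa using H _ _ hi

theorem realize_oneSentence :
    M ⊨ oneSentence S ↔ ∀ m : M, Structure.funMap (lamSymbol (1 : S)) ![m] = m := by
  simp only [Sentence.Realize, oneSentence, Formula.realize_iAlls, Formula.realize_equal,
    Term.realize_functions_apply₁, Term.realize_var, Sum.elim_inr]
  exact ⟨fun H m => H fun _ => m, fun H i => H _⟩

theorem realize_mulSentence (s t : S) :
    M ⊨ mulSentence s t ↔ ∀ m : M, Structure.funMap (lamSymbol (s * t)) ![m] =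
      Structure.funMap (lamSymbol s) ![Structure.funMap (lamSymbol t) ![m] ] := by
  simp only [Sentence.Realize, mulSentence, Formula.realize_iAlls, Formula.realize_equal,
    Term.realize_functions_apply₁, Term.realize_var, Sum.elim_inr]
  exact ⟨fun H m => H fun _ => m, fun H i => H _⟩

theorem IsAxiomatisable.isClosedUnderUltraproducts
    {K : (B : Type w) → MulAction S B → Prop} (h : IsAxiomatisable K) :
    IsClosedUnderUltraproducts K := by
  obtain ⟨T, hT⟩ := h
  intro I U B _ _ hB
  have : Nonempty ((U : Filter I).Product B) := Ultraproduct.Product.instNonempty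
  refine (hT _).1 ⟨fun φ hφ => ?_⟩
  rw [Ultraproduct.sentence_realize]
  exact Filter.Eventually.of_forall fun i => ((hT (B i)).2 (hB i)).realize_of_mem φ hφ

end Language

/-- For each skeleton and each `a`, finitely many skeletons over `aS` suffice to replace the
tossings over `S` in all principally weakly flat acts. -/
def HasFiniteReplacement (S : Type u) [Monoid S] : Prop :=
  ∀ (σ : Skeleton S) (a : S), ∃ F : Finset (Skeleton S),
    ∀ (B : Type w) [Nonempty B] [MulAction S B], IsPrincipallyWeaklyFlat S B →
      ∀ b b' : B, Connected σ a b a b' →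
        ∃ τ ∈ F, Connected τ (generator a) b (generator a) b'

theorem hasFiniteReplacement_of_isClosedUnderUltraproducts {S : Type u} [Monoid S]
    (h : IsClosedUnderUltraproducts (PWF.{u, max u v} S)) :
    HasFiniteReplacement.{u, max u v} S := by
  intro σ a
  by_contra! hF
  choose B hne act hB b b' hσ hτ using hF
  -- The lift places the index set in the universe of the acts.
  let I := ULift.{max u v} (Finset (Skeleton S))
  -- Refining `atTop` ensures that each fixed skeleton lies in `U`-almost every finite set.
  let U : Ultrafilter I := Ultrafilter.of (Filter.map ULift.up Filter.atTop)
  let C : I → Type (max u v) := fun i => B i.down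
  let : ∀ i, MulAction S (C i) := fun i => act i.down
  let : ∀ i, (actLanguage S).Structure (C i) := fun i => actStructure S (C i)
  have hc : ∀ (i : I) (s : S) (m : C i),
      Language.Structure.funMap (lamSymbol s) ![m] = s • m := fun _ _ _ => rfl
  obtain ⟨actP, hfun, hP⟩ := h I U C fun i => ⟨act i.down, fun _ _ => rfl, hB i.down⟩
  let v : Fin 2 → (i : I) → C i := ![fun i => b i.down, fun i => b' i.down]
  let p : Fin 2 → (U : Filter I).Product C := fun k => (v k : (U : Filter I).Product C)
  have los : ∀ τ : Skeleton S, LeftChain τ (p 0) (p 1) ↔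
      ∀ᶠ i in (U : Filter I), LeftChain τ (b i.down) (b' i.down) := by
    intro τ
    rw [← realize_chainFormula hfun τ p]
    refine (Language.Ultraproduct.realize_formula_cast (chainFormula τ) v).trans ?_
    exact Filter.eventually_congr
      (Filter.Eventually.of_forall fun i => realize_chainFormula (hc i) τ _)
  have hσP : Connected σ a (p 0) a (p 1) := connected_iff.2
    -- The right chain lives in `S` alone, so any index supplies it; `∅` is arbitrary.
    ⟨(connected_iff.1 (hσ ∅)).1,
      (los σ).2 (Filter.Eventually.of_forall fun i => (connected_iff.1 (hσ i.down)).2)⟩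
  obtain ⟨τ, hτP⟩ := isPrincipallyWeaklyFlat_iff.1 hP a _ _ σ hσP
  obtain ⟨hx, hy⟩ := connected_iff.1 hτP
  have hmem : ∀ᶠ i in (U : Filter I), τ ∈ i.down :=
    Ultrafilter.of_le _ (Filter.eventually_map.2
      ((Filter.eventually_ge_atTop {τ}).mono fun F hF => hF (Finset.mem_singleton_self τ)))
  obtain ⟨i, hi, hi'⟩ := (((los τ).1 hy).and hmem).exists
  exact hτ i.down τ hi' (connected_iff.2 ⟨hx, hi⟩)

theorem HasFiniteReplacement.isAxiomatisable {S : Type u} [Monoid S]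
    (h : HasFiniteReplacement.{u, w} S) : IsAxiomatisable (PWF.{u, w} S) := by
  classical
  -- With the full theory of the class as axioms, members are models at once; only the converse
  -- needs explicit sentences.
  refine ⟨{φ | ∀ (M : Type w) [Nonempty M] [(actLanguage S).Structure M],
    InClass (PWF.{u, w} S) M → M ⊨ φ}, fun M _ _ => ⟨fun hM => ?_, fun hM => ⟨fun φ hφ => hφ M hM⟩⟩⟩
  have hone := realize_oneSentence.1 (hM.realize_of_mem (oneSentence S) (by
    rintro N _ _ ⟨act, hN, -⟩
    exact realize_oneSentence.2 fun m => (hN 1 m).trans (one_smul S m)))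
  have hmul := fun s t : S => (realize_mulSentence s t).1
    (hM.realize_of_mem (mulSentence s t) (by
      rintro N _ _ ⟨act, hN, -⟩
      refine (realize_mulSentence s t).2 fun m => ?_
      rw [hN, hN, hN, mul_smul]))
  let act : MulAction S M :=
    { smul := fun s m => Language.Structure.funMap (lamSymbol s) ![m]
      one_smul := hone
      mul_smul := hmul }
  have hfun : ∀ (s : S) (m : M), Language.Structure.funMap (lamSymbol s) ![m] = s • m :=
    fun _ _ => rfl
  refine ⟨act, hfun, isPrincipallyWeaklyFlat_iff.2 fun a b b' σ hσ => ?_⟩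
  obtain ⟨F, hF⟩ := h σ a
  obtain ⟨hx, hy⟩ := connected_iff.1 hσ
  -- `chainSentence` sees only left chains, so skeletons with no right chain in `aS` must be
  -- discarded beforehand.
  let F' := F.filter fun τ => RightChain τ (generator a) (generator a)
  have hmem : M ⊨ chainSentence σ F' := hM.realize_of_mem _ (by
    rintro N _ _ ⟨actN, hN, hflat⟩
    refine (realize_chainSentence hN σ F').2 fun c c' hc => ?_
    obtain ⟨τ, hτ, hcon⟩ := hF N hflat c c' (connected_iff.2 ⟨hx, hc⟩)
    obtain ⟨h₁, h₂⟩ := connected_iff.1 hcon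
    exact ⟨τ, Finset.mem_filter.2 ⟨hτ, h₁⟩, h₂⟩)
  obtain ⟨τ, hτ, hc⟩ := (realize_chainSentence hfun σ F').1 hmem b b' hy
  exact ⟨τ, connected_iff.2 ⟨(Finset.mem_filter.1 hτ).2, hc⟩⟩

end MonoidAct


theorem corollary3p10 (S : Type u) [Monoid S] :
    List.TFAE [
      MonoidAct.IsAxiomatisable (MonoidAct.PWF.{u, max u v} S),
      MonoidAct.IsClosedUnderUltraproducts (MonoidAct.PWF.{u, max u v} S),
      ∀ (σ : MonoidAct.Skeleton S) (a : S), ∃ F : Finset (MonoidAct.Skeleton S),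
        ∀ (B : Type (max u v)) [Nonempty B] [MulAction S B],
          MonoidAct.IsPrincipallyWeaklyFlat S B →
          ∀ b b' : B, MonoidAct.Connected σ a b a b' →
            ∃ τ ∈ F, MonoidAct.Connected τ
              (MonoidAct.generator a) b (MonoidAct.generator a) b'] := by
  tfae_have 1 → 2 := MonoidAct.IsAxiomatisable.isClosedUnderUltraproducts
  tfae_have 2 → 3 := MonoidAct.hasFiniteReplacement_of_isClosedUnderUltraproducts.{u, v}
  tfae_have 3 → 1 := fun h => MonoidAct.HasFiniteReplacement.isAxiomatisable.{u, max u v} h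
  tfae_finish
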